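/- A plane curve is a generic immersion $\mathcal C : S^1 \to \mathbb R^2$, i.e. a $C^1$ map with nowhere vanishing velocity, with no points of multiplicity greater than two, and such that at every double point the two velocity vectors are linearly independent. A Gauss diagram is the circle $S^1$ together with finitely many chords (unordered pairs of distinct points of $S^1$), no two of which share an endpoint; two Gauss diagrams are identified if a homeomorphism of the circle carries the chords of one onto the chords of the other. Two chords cross (intersect) if the endpoints of one lie in the two different open arcs into which the endpoints of the other divide the circle; for a chord $\mathfrak c$ of $\mathfrak G$ let $\mathfrak c_\times$ be the set of all chords of $\mathfrak G$ that cross $\mathfrak c$. The Gauss diagram of a plane curve $\mathcal C$ is the circle with the two preimages of each double point of $\mathcal C$ joined by a chord. A Gauss diagram is realizable if it is (up to the above identification) the Gauss diagram of some plane curve. **Proposition 3.1.** Let $\mathcal C : S^1 \to \mathbb R^2$ be a plane curve and $\mathfrak G$ its Gauss diagram. Then 1. $|\mathfrak a_\times \cap \mathfrak b_\times| \equiv 0 \pmod 2$ for every two non-intersecting chords $\mathfrak a, \mathfrak b \in \mathfrak G$; 2. $|\mathfrak c_\times| \equiv 0 \pmod 2$ for every chord $\mathfrak c \in \mathfrak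 G$. **Corollary 3.1 (The Even Condition).** If a Gauss diagram $\mathfrak G$ is realizable, then it satisfies the even condition: the number of chords of $\mathfrak G$ crossing both of any two non-intersecting chords is even, and the number of chords of $\mathfrak G$ crossing any given chord is even (zero included). -/

import Mathlib

open Set Filter Topology

/-- A plane curve: a generic immersion of the circle `ℝ/ℤ` into the Euclidean plane, i.e. a `C¹` map
with nowhere vanishing velocity, all of whose multiple points are transversal double points. -/
structure PlaneCurve where
  /-- The underlying map of the circle into the plane. -/
  toFun : UnitAddCircle → EuclideanSpace ℝ (Fin 2)
  contDiff : ContDiff ℝ 1 (fun t : ℝ => toFun (t : UnitAddCircle))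
  immersion : ∀ t : ℝ, deriv (fun t : ℝ => toFun (t : UnitAddCircle)) t ≠ 0
  no_triple : ∀ x y z : UnitAddCircle, toFun x = toFun y → toFun y = toFun z →
    x = y ∨ y = z ∨ x = z
  transversal : ∀ s t : ℝ, (s : UnitAddCircle) ≠ (t : UnitAddCircle) →
    toFun (s : UnitAddCircle) = toFun (t : UnitAddCircle) →
    LinearIndependent ℝ ![deriv (fun t : ℝ => toFun (t : UnitAddCircle)) s,
      deriv (fun t : ℝ => toFun (t : UnitAddCircle)) t]

/-- A Gauss diagram (chord diagram): the circle together with finitely many chords, a chord being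
an unordered pair of distinct points of the circle, such that no two chords share an endpoint. -/
structure GaussDiagram where
  /-- The set of chords. -/
  chords : Set (Sym2 UnitAddCircle)
  finite : chords.Finite
  not_isDiag : ∀ c ∈ chords, ¬ c.IsDiag
  eq_of_mem : ∀ c ∈ chords, ∀ d ∈ chords, ∀ x, x ∈ c → x ∈ d → c = d

/-- Two chords cross if the endpoints of the second one lie in the two different open arcs into
which the endpoints of the first one divide the circle. (`sbtw a x b` says that `x` lies in the
open arc that leads from `a` to `b` in the positive direction.) -/
def Crosses (c d : Sym2 UnitAddCircle) : Prop :=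
  ∃ a b x y : UnitAddCircle, c = s(a, b) ∧ d = s(x, y) ∧ sbtw a x b ∧ sbtw b y a

namespace GaussDiagram

/-- The set of all chords of `G` that cross `c`. -/
def crossing (G : GaussDiagram) (c : Sym2 UnitAddCircle) : Set (Sym2 UnitAddCircle) :=
  {d | d ∈ G.chords ∧ Crosses c d}

/-- The even condition: the number of chords that cross both of two non-intersecting chords is
even, and so is the number of chords that cross any given chord. -/
def EvenCondition (G : GaussDiagram) : Prop :=
  (∀ a ∈ G.chords, ∀ b ∈ G.chords, ¬ Crosses a b → Even (G.crossing a ∩ G.crossing b).ncard) ∧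
  (∀ c ∈ G.chords, Even (G.crossing c).ncard)

/-- Two Gauss diagrams are equivalent if a homeomorphism of the circle carries the chords of one
onto the chords of the other. -/
def Equivalent (G H : GaussDiagram) : Prop :=
  ∃ φ : UnitAddCircle ≃ₜ UnitAddCircle, Sym2.map φ '' G.chords = H.chords

end GaussDiagram

namespace PlaneCurve

/-- The pairs of distinct points of the circle with the same image are finite in number. -/
theorem finite_doublePairs (C : PlaneCurve) :
    {p : UnitAddCircle × UnitAddCircle | p.1 ≠ p.2 ∧ C.toFun p.1 = C.toFun p.2}.Finite := by
  by_contra hinf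
  obtain ⟨p, hp⟩ := Set.Infinite.exists_accPt_principal hinf
  obtain ⟨⟨s⟩, ⟨t⟩⟩ := p
  rw [accPt_iff_frequently] at hp
  refine hp ?_
  set f : ℝ → EuclideanSpace ℝ (Fin 2) := fun t => C.toFun (t : UnitAddCircle) with hf
  have hd : ∀ r, HasStrictDerivAt f (deriv f r) r := fun r =>
    C.contDiff.contDiffAt.hasStrictDerivAt (by norm_num)
  -- the claim upstairs, in the universal cover
  have key : ∀ s t : ℝ, ((s : UnitAddCircle) = t → s = t) → ∀ᶠ z : ℝ × ℝ in 𝓝 (s, t),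
      (z.1 : UnitAddCircle) ≠ (z.2 : UnitAddCircle) → f z.1 = f z.2 → z = (s, t) := by
    intro s t hst
    by_cases h : s = t
    · subst h
      have h1 := (hasStrictDerivAt_iff_hasStrictFDerivAt.1 (hd s)).isLittleO.def
        (half_pos (norm_pos_iff.2 (C.immersion s)))
      filter_upwards [h1] with z hz hne heq
      exfalso
      rw [heq] at hz
      simp only [sub_self, zero_sub, norm_neg, ContinuousLinearMap.toSpanSingleton_apply,
        norm_smul] at hz
      have hpos : 0 < ‖z.1 - z.2‖ :=
        norm_pos_iff.2 (sub_ne_zero.2 fun h => hne (by rw [h]))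
      have hv := norm_pos_iff.2 (C.immersion s)
      change ‖z.1 - z.2‖ * ‖deriv f s‖ ≤ ‖deriv f s‖ / 2 * ‖z.1 - z.2‖ at hz
      change 0 < ‖deriv f s‖ at hv
      nlinarith [mul_pos hpos hv]
    · have hne : (s : UnitAddCircle) ≠ t := fun h' => h (hst h')
      by_cases hfe : f s = f t
      · have hli := C.transversal s t hne hfe
        rw [LinearIndependent.pair_iff] at hli
        have hg : HasFDerivAt (fun z : ℝ × ℝ => f z.1 - f z.2)
            ((ContinuousLinearMap.toSpanSingleton ℝ (deriv f s)).comp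
                (ContinuousLinearMap.fst ℝ ℝ ℝ) -
              (ContinuousLinearMap.toSpanSingleton ℝ (deriv f t)).comp
                (ContinuousLinearMap.snd ℝ ℝ ℝ)) (s, t) :=
          HasFDerivAt.sub
            (HasFDerivAt.comp (g := f) (f := Prod.fst) (s, t)
              (hd s).hasDerivAt.hasFDerivAt hasFDerivAt_fst)
            (HasFDerivAt.comp (g := f) (f := Prod.snd) (s, t)
              (hd t).hasDerivAt.hasFDerivAt hasFDerivAt_snd)
        set L := (ContinuousLinearMap.toSpanSingleton ℝ (deriv f s)).comp
                (ContinuousLinearMap.fst ℝ ℝ ℝ) -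
              (ContinuousLinearMap.toSpanSingleton ℝ (deriv f t)).comp
                (ContinuousLinearMap.snd ℝ ℝ ℝ) with hL
        have hker : LinearMap.ker (L : ℝ × ℝ →ₗ[ℝ] EuclideanSpace ℝ (Fin 2)) = ⊥ := by
          rw [LinearMap.ker_eq_bot']
          rintro ⟨a, b⟩ hab
          have := hli a (-b) (by simpa [hL, sub_eq_add_neg] using hab)
          ext
          · exact this.1
          · simpa using this.2
        obtain ⟨K, -, hK⟩ := LinearMap.exists_antilipschitzWith _ hker
        have hev := hg.eventually_ne (c := 0) ⟨K, hK⟩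
        rw [eventually_nhdsWithin_iff] at hev
        filter_upwards [hev] with z hz _ heq
        by_contra hzz
        exact hz hzz (sub_eq_zero.2 heq)
      · have hc : Continuous f := C.contDiff.continuous
        have : ∀ᶠ z : ℝ × ℝ in 𝓝 (s, t), f z.1 ≠ f z.2 :=
          (isOpen_ne_fun (hc.comp continuous_fst) (hc.comp continuous_snd)).mem_nhds hfe
        filter_upwards [this] with z hz _ heq
        exact absurd heq hz
  have key2 : ∀ s t : ℝ, ((s : UnitAddCircle) = t → s = t) →
      ∀ᶠ q : UnitAddCircle × UnitAddCircle in 𝓝 ((s : UnitAddCircle), (t : UnitAddCircle)),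
      ¬ (q ≠ ((s : UnitAddCircle), (t : UnitAddCircle)) ∧ q.1 ≠ q.2 ∧
        C.toFun q.1 = C.toFun q.2) := by
    intro s t hst
    have hm : 𝓝 ((s : UnitAddCircle), (t : UnitAddCircle)) =
        Filter.map (Prod.map ((↑) : ℝ → UnitAddCircle) ((↑) : ℝ → UnitAddCircle)) (𝓝 (s, t)) := by
      rw [nhds_prod_eq, nhds_prod_eq, ← Filter.prod_map_map_eq']
      exact congrArg₂ _ (QuotientAddGroup.nhds_eq _ s) (QuotientAddGroup.nhds_eq _ t)
    rw [hm, Filter.eventually_map]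
    filter_upwards [key s t hst] with z hz hq
    exact hq.1 (by rw [hz hq.2.1 hq.2.2]; rfl)
  by_cases h : (s : UnitAddCircle) = (t : UnitAddCircle)
  · have := key2 s s (fun _ => rfl)
    have hp : ((s : UnitAddCircle), (s : UnitAddCircle)) =
        ((s : UnitAddCircle), (t : UnitAddCircle)) := by rw [← h]
    rw [hp] at this
    exact this
  · exact key2 s t (fun h' => absurd h' h)

/-- The Gauss diagram of a plane curve: the circle with the two preimages of each double point
connected by a chord. -/
def gaussDiagram (C : PlaneCurve) : GaussDiagram where
  chords := {c | ∃ x y : UnitAddCircle, x ≠ y ∧ C.toFun x = C.toFun y ∧ c = s(x, y)}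
  finite := by
    refine (C.finite_doublePairs.image (fun p => s(p.1, p.2))).subset ?_
    rintro c ⟨x, y, hne, h, rfl⟩
    exact ⟨(x, y), ⟨hne, h⟩, rfl⟩
  not_isDiag := by
    rintro c ⟨x, y, hne, -, rfl⟩
    simpa using hne
  eq_of_mem := by
    have aux : ∀ x y x' : UnitAddCircle, x ≠ y → C.toFun x = C.toFun y → x ≠ x' →
        C.toFun x = C.toFun x' → y = x' := by
      intro x y x' h1 h2 h3 h4
      rcases C.no_triple y x x' h2.symm h4 with h | h | h
      · exact absurd h.symm h1
      · exact absurd h h3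
      · exact h
    rintro c ⟨x, y, hne, h, rfl⟩ d ⟨x', y', hne', h', rfl⟩ z hz hz'
    rw [Sym2.mem_iff] at hz hz'
    rcases hz with rfl | rfl <;> rcases hz' with rfl | rfl
    · rw [aux z y y' hne h hne' h']
    · rw [aux z y x' hne h hne'.symm h'.symm, Sym2.eq_swap]
    · rw [aux z x y' hne.symm h.symm hne' h', Sym2.eq_swap]
    · rw [aux z x x' hne.symm h.symm hne'.symm h'.symm]

end PlaneCurve

/-- A Gauss diagram is realizable if it is, up to equivalence, the Gauss diagram of some plane
curve. -/
def GaussDiagram.IsRealizable (G : GaussDiagram) : Prop :=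
  ∃ C : PlaneCurve, C.gaussDiagram.Equivalent G

open MeasureTheory

/-! Two closed subarcs `C|[s,t]` and `C|[c,d]` of the curve give the map `F(x, y) = C(x) - C(y)` on
a rectangle. It factors through a torus, so it has degree zero as a map to the plane. Its
nondegenerate zeros are transversal crossings and contribute local degrees ±1; if there are no
others, their signed count is 0 and their number is even. The degree is handled by integration: the
pull-back under `F` of a bump form integrates to zero because the form is exact
(`integral_diff_pullback_eq_zero`), while a change of variables near each zero gives its sign
(`even_card_zeros_of_integral_eq_zero`).

Two non-crossing distinct chords cut off disjoint closed subarcs, and the chords crossing both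
correspond to the intersections of these subarcs. A single chord cuts the curve into two closed
subarcs that share the double point, so `F` also vanishes at the corners of the rectangle. These
zeros are discarded by evaluating the degree at small values in a half-plane that `F` misses near
the corners; transversality at the double point provides the half-plane
(`even_ncard_crossingParams_complement`).

For realizable diagrams it remains to see that crossing is invariant under homeomorphisms of the
circle, which follows from a description by connectedness. -/

/-! ### Arcs and crossing chords in real parameters. -/

theorem sbtw_coe_iff {s t : ℝ} (hst : s < t) (hts : t < s + 1) (x : UnitAddCircle) :
    sbtw (s : UnitAddCircle) x t ↔ ∃ r ∈ Ioo s t, (r : UnitAddCircle) = x := by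
  obtain ⟨x, rfl⟩ := QuotientAddGroup.mk_surjective x
  have hp : (0 : ℝ) < 1 := one_pos
  -- `toIocMod` picks the lift of `x` in `(s, s + 1]`; the point `s` itself is lifted to `s + 1 > t`
  -- and thereby excluded.
  have h1 : sbtw (s : UnitAddCircle) (x : UnitAddCircle) t ↔ toIocMod hp s x < t := by
    rw [sbtw_iff_not_btw, ← btw_cyclic, ← btw_cyclic, ← not_le]
    refine not_congr ?_
    refine QuotientAddGroup.btw_coe_iff.trans ?_
    rw [(toIcoMod_eq_self hp).2 ⟨hst.le, hts⟩]
  refine h1.trans ⟨fun h => ⟨_, ⟨left_lt_toIocMod hp s x, h⟩, ?_⟩, ?_⟩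
  · rw [← self_sub_toIocDiv_zsmul]
    refine (QuotientAddGroup.eq_iff_sub_mem.2 ?_)
    exact AddSubgroup.mem_zmultiples_iff.2 ⟨-toIocDiv hp s x, by simp⟩
  · rintro ⟨r, hr, hrx⟩
    have : toIocMod hp s x = r := by
      rw [toIocMod_eq_iff hp]
      refine ⟨⟨hr.1, (hr.2.trans hts).le⟩, ?_⟩
      obtain ⟨n, hn⟩ := AddSubgroup.mem_zmultiples_iff.1 (QuotientAddGroup.eq_iff_sub_mem.1 hrx)
      exact ⟨-n, by rw [neg_smul, hn]; ring⟩
    rw [this]; exact hr.2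

theorem sbtw_coe_iff' {s t : ℝ} (hst : s < t) (hts : t < s + 1) (x : UnitAddCircle) :
    sbtw (t : UnitAddCircle) x s ↔ ∃ r ∈ Ioo t (s + 1), (r : UnitAddCircle) = x := by
  rw [← sbtw_coe_iff hts (by linarith), AddCircle.coe_add_period]

theorem exists_coe_eq_Ico (s : ℝ) (x : UnitAddCircle) :
    ∃ r ∈ Ico s (s + 1), (r : UnitAddCircle) = x := by
  exact (AddCircle.coe_image_Ico_eq (1 : ℝ) s).ge (mem_univ x)

theorem coe_inj_of_mem_Ico {s x y : ℝ} (hx : x ∈ Ico s (s + 1)) (hy : y ∈ Ico s (s + 1))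
    (h : (x : UnitAddCircle) = y) : x = y :=
  (AddCircle.coe_eq_coe_iff_of_mem_Ico hx hy).1 h

/-- Two distinct points of the circle have lifts at distance less than a period. -/
theorem exists_lift_pair {a b : UnitAddCircle} (h : a ≠ b) :
    ∃ s t : ℝ, s < t ∧ t < s + 1 ∧ (s : UnitAddCircle) = a ∧ (t : UnitAddCircle) = b := by
  obtain ⟨s, rfl⟩ := QuotientAddGroup.mk_surjective a
  obtain ⟨t, ht, rfl⟩ := exists_coe_eq_Ico s b
  refine ⟨s, t, lt_of_le_of_ne ht.1 ?_, ht.2, rfl, rfl⟩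
  rintro rfl
  exact h rfl

theorem crosses_coe_iff {s t : ℝ} (hst : s < t) (hts : t < s + 1) (d : Sym2 UnitAddCircle) :
    Crosses s((s : UnitAddCircle), (t : UnitAddCircle)) d ↔
      ∃ x ∈ Ioo s t, ∃ y ∈ Ioo t (s + 1), d = s((x : UnitAddCircle), (y : UnitAddCircle)) := by
  constructor
  · rintro ⟨a, b, x, y, hab, rfl, h1, h2⟩
    rcases Sym2.eq_iff.1 hab with ⟨rfl, rfl⟩ | ⟨rfl, rfl⟩
    · obtain ⟨x, hx, rfl⟩ := (sbtw_coe_iff hst hts _).1 h1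
      obtain ⟨y, hy, rfl⟩ := (sbtw_coe_iff' hst hts _).1 h2
      exact ⟨x, hx, y, hy, rfl⟩
    · obtain ⟨x, hx, rfl⟩ := (sbtw_coe_iff' hst hts _).1 h1
      obtain ⟨y, hy, rfl⟩ := (sbtw_coe_iff hst hts _).1 h2
      exact ⟨y, hy, x, hx, Sym2.eq_swap⟩
  · rintro ⟨x, hx, y, hy, rfl⟩
    exact ⟨s, t, x, y, rfl, rfl, (sbtw_coe_iff hst hts _).2 ⟨x, hx, rfl⟩,
      (sbtw_coe_iff' hst hts _).2 ⟨y, hy, rfl⟩⟩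

theorem isPreconnected_coe_image {s : Set ℝ} (hs : s.OrdConnected) :
    IsPreconnected (((↑) : ℝ → UnitAddCircle) '' s) :=
  (isPreconnected_iff_ordConnected.2 hs).image _
    (AddCircle.continuous_mk' (1 : ℝ)).continuousOn

theorem isOpen_coe_image {s : Set ℝ} (hs : IsOpen s) :
    IsOpen (((↑) : ℝ → UnitAddCircle) '' s) :=
  QuotientAddGroup.isOpenMap_coe _ hs

/-! ### Invariance of crossing and of the even condition under homeomorphisms. -/

/-- Crossing of chords in terms of connectedness alone. -/
theorem crosses_iff_forall_isPreconnected {a b x y : UnitAddCircle} (hab : a ≠ b) :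
    Crosses s(a, b) s(x, y) ↔ x ∉ ({a, b} : Set UnitAddCircle) ∧ y ∉ ({a, b} : Set UnitAddCircle) ∧
      ∀ S ⊆ ({a, b} : Set UnitAddCircle)ᶜ, IsPreconnected S → x ∈ S → y ∉ S := by
  obtain ⟨s, t, hst, hts, rfl, rfl⟩ := exists_lift_pair hab
  have hne : ∀ r ∈ Ioo s t ∪ Ioo t (s + 1),
      (r : UnitAddCircle) ∉ ({(s : UnitAddCircle), (t : UnitAddCircle)} : Set _) := by
    rintro r hr (h | h)
    · have := coe_inj_of_mem_Ico (s := s)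
        (by rcases hr with hr | hr <;> constructor <;> linarith [hr.1, hr.2])
        (by constructor <;> linarith) h
      rcases hr with hr | hr <;> linarith [hr.1, hr.2]
    · have := coe_inj_of_mem_Ico (s := s)
        (by rcases hr with hr | hr <;> constructor <;> linarith [hr.1, hr.2])
        (by constructor <;> linarith) h
      rcases hr with hr | hr <;> linarith [hr.1, hr.2]
  have hcov : ∀ z ∉ ({(s : UnitAddCircle), (t : UnitAddCircle)} : Set UnitAddCircle),
      ∃ r ∈ Ioo s t ∪ Ioo t (s + 1), (r : UnitAddCircle) = z := by
    intro z hz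
    obtain ⟨r, hr, rfl⟩ := exists_coe_eq_Ico s z
    refine ⟨r, ?_, rfl⟩
    have h1 : r ≠ s := fun h => hz (by simp [h])
    have h2 : r ≠ t := fun h => hz (by simp [h])
    rcases lt_or_gt_of_ne h2 with h | h
    · exact Or.inl ⟨lt_of_le_of_ne hr.1 h1.symm, h⟩
    · exact Or.inr ⟨h, hr.2⟩
  have hdisj : Disjoint (((↑) : ℝ → UnitAddCircle) '' Ioo s t)
      (((↑) : ℝ → UnitAddCircle) '' Ioo t (s + 1)) := by
    rw [Set.disjoint_left]
    rintro _ ⟨r, hr, rfl⟩ ⟨r', hr', h⟩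
    have := coe_inj_of_mem_Ico (s := s) ⟨by linarith [hr'.1], hr'.2⟩
      ⟨hr.1.le, by linarith [hr.2]⟩ h
    linarith [hr.2, hr'.1]
  -- The two open arcs are disjoint, open and cover the complement of the endpoints, so a
  -- preconnected set in this complement lies in one of them.
  have hsep : ∀ S ⊆ ({(s : UnitAddCircle), (t : UnitAddCircle)} : Set UnitAddCircle)ᶜ,
      IsPreconnected S → ∀ p ∈ Ioo s t, ∀ q ∈ Ioo t (s + 1), (p : UnitAddCircle) ∈ S →
      (q : UnitAddCircle) ∉ S := by
    intro S hS hc p hp q hq hpS hqS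
    obtain ⟨z, -, hz1, hz2⟩ := hc _ _ (isOpen_coe_image (isOpen_Ioo (a := s) (b := t)))
      (isOpen_coe_image (isOpen_Ioo (a := t) (b := s + 1)))
      (fun z hz => by
        obtain ⟨r, hr | hr, rfl⟩ := hcov z (hS hz)
        · exact Or.inl ⟨r, hr, rfl⟩
        · exact Or.inr ⟨r, hr, rfl⟩)
      ⟨_, hpS, p, hp, rfl⟩ ⟨_, hqS, q, hq, rfl⟩
    exact hdisj.le_bot ⟨hz1, hz2⟩
  rw [crosses_coe_iff hst hts]
  constructor
  · rintro ⟨p, hp, q, hq, h⟩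
    rcases Sym2.eq_iff.1 h with ⟨rfl, rfl⟩ | ⟨rfl, rfl⟩
    · exact ⟨hne p (Or.inl hp), hne q (Or.inr hq), fun S hS hc => hsep S hS hc p hp q hq⟩
    · exact ⟨hne q (Or.inr hq), hne p (Or.inl hp),
        fun S hS hc h1 h2 => hsep S hS hc p hp q hq h2 h1⟩
  · rintro ⟨hx, hy, h⟩
    obtain ⟨p, hp, rfl⟩ := hcov x hx
    obtain ⟨q, hq, rfl⟩ := hcov y hy
    rcases hp with hp | hp <;> rcases hq with hq | hq
    -- Both points lie on the same open arc, which is itself a connected set joining them.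
    · refine absurd (mem_image_of_mem _ hq) (h _ ?_ (isPreconnected_coe_image ordConnected_Ioo)
        (mem_image_of_mem _ hp))
      rintro _ ⟨r, hr, rfl⟩
      exact hne r (Or.inl hr)
    · exact ⟨p, hp, q, hq, rfl⟩
    · exact ⟨q, hq, p, hp, Sym2.eq_swap⟩
    · refine absurd (mem_image_of_mem _ hq) (h _ ?_ (isPreconnected_coe_image ordConnected_Ioo)
        (mem_image_of_mem _ hp))
      rintro _ ⟨r, hr, rfl⟩
      exact hne r (Or.inr hr)

/-- A homeomorphism may reverse the orientation, which `sbtw` does not survive; the criterion by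
preconnected sets does not mention orientation and transfers by preimages. -/
theorem Crosses.map_homeomorph (φ : UnitAddCircle ≃ₜ UnitAddCircle) {c d : Sym2 UnitAddCircle}
    (hc : ¬ c.IsDiag) (h : Crosses c d) : Crosses (Sym2.map φ c) (Sym2.map φ d) := by
  induction c with | _ a b
  induction d with | _ x y
  have hab : a ≠ b := by simpa using hc
  rw [crosses_iff_forall_isPreconnected hab] at h
  rw [Sym2.map_mk, Sym2.map_mk,
    crosses_iff_forall_isPreconnected (φ.injective.ne hab)]
  obtain ⟨hx, hy, h⟩ := h
  have him : ({φ a, φ b} : Set UnitAddCircle) = φ '' {a, b} := by rw [image_pair]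
  rw [him]
  refine ⟨by rwa [φ.injective.mem_set_image], by rwa [φ.injective.mem_set_image],
    fun S hS hpre hxS hyS => h (φ ⁻¹' S) ?_ ?_ hxS hyS⟩
  · intro z hz hz'
    exact hS hz (mem_image_of_mem _ hz')
  · exact φ.isPreconnected_preimage.2 hpre

theorem crosses_map_homeomorph_iff (φ : UnitAddCircle ≃ₜ UnitAddCircle) {c d : Sym2 UnitAddCircle}
    (hc : ¬ c.IsDiag) : Crosses (Sym2.map φ c) (Sym2.map φ d) ↔ Crosses c d := by
  refine ⟨fun h => ?_, fun h => h.map_homeomorph φ hc⟩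
  have hc' : ¬ (Sym2.map φ c).IsDiag := by
    rwa [Sym2.isDiag_map φ.injective]
  simpa [Sym2.map_map] using h.map_homeomorph φ.symm hc'

theorem GaussDiagram.EvenCondition.of_equivalent {G H : GaussDiagram} (h : G.Equivalent H)
    (hG : G.EvenCondition) : H.EvenCondition := by
  obtain ⟨φ, hφ⟩ := h
  have hinj : Function.Injective (Sym2.map φ) := Sym2.map.injective φ.injective
  have hcr : ∀ c ∈ G.chords, H.crossing (Sym2.map φ c) = Sym2.map φ '' G.crossing c := by
    intro c hc
    ext d
    constructor
    · rintro ⟨hd, hcd⟩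
      rw [← hφ] at hd
      obtain ⟨d, hd, rfl⟩ := hd
      exact ⟨d, ⟨hd, (crosses_map_homeomorph_iff φ (G.not_isDiag c hc)).1 hcd⟩, rfl⟩
    · rintro ⟨d, ⟨hd, hcd⟩, rfl⟩
      exact ⟨hφ ▸ mem_image_of_mem _ hd,
        (crosses_map_homeomorph_iff φ (G.not_isDiag c hc)).2 hcd⟩
  constructor
  · intro a ha b hb hab
    rw [← hφ] at ha hb
    obtain ⟨a, ha, rfl⟩ := ha
    obtain ⟨b, hb, rfl⟩ := hb
    rw [crosses_map_homeomorph_iff φ (G.not_isDiag a ha)] at hab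
    rw [hcr a ha, hcr b hb, ← image_inter hinj, ncard_image_of_injective _ hinj]
    exact hG.1 a ha b hb hab
  · intro c hc
    rw [← hφ] at hc
    obtain ⟨c, hc, rfl⟩ := hc
    rw [hcr c hc, ncard_image_of_injective _ hinj]
    exact hG.2 c hc

/-! ### Degree zero by integration, and parity of the number of zeros. -/

/-- For two closed arcs of the plane curve `(f, g)`, the pull-back of an area form along the
difference of the two arcs has vanishing integral, the form being exact on the plane. -/
theorem integral_diff_pullback_eq_zero {f g β γ : ℝ → ℝ} (hf : ContDiff ℝ 1 f)
    (hg : ContDiff ℝ 1 g) (hβ : Continuous β) (hγ : ContDiff ℝ 1 γ) {s t c d : ℝ}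
    (hfst : f s = f t) (hgst : g s = g t) (hfcd : f c = f d) (hgcd : g c = g d) (p q : ℝ) :
    ∫ x in s..t, ∫ y in c..d, β (f x - f y - p) * γ (g x - g y - q) *
      (deriv f y * deriv g x - deriv f x * deriv g y) = 0 := by
  -- The area form has the primitive `B(u) γ(v) dv`, since `β(u) γ(v) du ∧ dv = d(B(u) γ(v) dv)`.
  set B : ℝ → ℝ := fun u => ∫ v in (0 : ℝ)..u, β v with hB
  have hB' : ∀ u, HasDerivAt B (β u) u := fun u =>
    intervalIntegral.integral_hasDerivAt_right (hβ.intervalIntegrable _ _)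
      hβ.aestronglyMeasurable.stronglyMeasurableAtFilter hβ.continuousAt
  have hBc : Continuous B := continuous_iff_continuousAt.2 fun u => (hB' u).continuousAt
  have hf' : ∀ x, HasDerivAt f (deriv f x) x := fun x =>
    (hf.differentiable (by norm_num) x).hasDerivAt
  have hg' : ∀ x, HasDerivAt g (deriv g x) x := fun x =>
    (hg.differentiable (by norm_num) x).hasDerivAt
  have hγ' : ∀ x, HasDerivAt γ (deriv γ x) x := fun x =>
    (hγ.differentiable (by norm_num) x).hasDerivAt
  have cf : Continuous f := hf.continuous
  have cg : Continuous g := hg.continuous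
  have cγ : Continuous γ := hγ.continuous
  have cf' : Continuous (deriv f) := hf.continuous_deriv (by norm_num)
  have cg' : Continuous (deriv g) := hg.continuous_deriv (by norm_num)
  have cγ' : Continuous (deriv γ) := hγ.continuous_deriv (by norm_num)
  set Ψ : ℝ → ℝ → ℝ := fun x y => B (f x - f y - p) * γ (g x - g y - q) with hΨ
  set Ψx : ℝ → ℝ → ℝ := fun x y => β (f x - f y - p) * deriv f x * γ (g x - g y - q) +
    B (f x - f y - p) * (deriv γ (g x - g y - q) * deriv g x) with hΨx
  set Ψy : ℝ → ℝ → ℝ := fun x y => β (f x - f y - p) * (-deriv f y) * γ (g x - g y - q) +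
    B (f x - f y - p) * (deriv γ (g x - g y - q) * (-deriv g y)) with hΨy
  have hx : ∀ x y, HasDerivAt (fun x => Ψ x y) (Ψx x y) x := fun x y =>
    ((hB' _).comp x (((hf' x).sub_const _).sub_const p)).mul
      ((hγ' _).comp x (((hg' x).sub_const _).sub_const q))
  have hy : ∀ x y, HasDerivAt (fun y => Ψ x y) (Ψy x y) y := fun x y =>
    ((hB' _).comp y (((hf' y).const_sub _).sub_const p)).mul
      ((hγ' _).comp y (((hg' y).const_sub _).sub_const q))
  have cΨx : Continuous (Function.uncurry Ψx) := by
    simp only [hΨx, Function.uncurry_def]; fun_prop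
  have cΨy : Continuous (Function.uncurry Ψy) := by
    simp only [hΨy, Function.uncurry_def]; fun_prop
  -- The terms with `deriv γ` cancel. The factor of `Ψx` depends on `y` only and that of `Ψy` on `x`
  -- only, so each product integrates to zero in one variable over a closed arc, and no second
  -- derivatives of `f` and `g` are needed.
  have e : ∀ x y, β (f x - f y - p) * γ (g x - g y - q) *
      (deriv f y * deriv g x - deriv f x * deriv g y) =
      -deriv g y * Ψx x y - deriv g x * Ψy x y := by
    intro x y; simp only [hΨx, hΨy]; ring
  have iy : ∀ x, ∫ y in c..d, Ψy x y = 0 := by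
    intro x
    rw [intervalIntegral.integral_eq_sub_of_hasDerivAt (fun y _ => hy x y)
      ((cΨy.comp (Continuous.prodMk_right x)).intervalIntegrable _ _)]
    simp [hΨ, hfcd, hgcd]
  have ix : ∀ y, ∫ x in s..t, Ψx x y = 0 := by
    intro y
    rw [intervalIntegral.integral_eq_sub_of_hasDerivAt (fun x _ => hx x y)
      ((cΨx.comp (Continuous.prodMk_left y)).intervalIntegrable _ _)]
    simp [hΨ, hfst, hgst]
  have e2 : ∀ x, ∫ y in c..d, β (f x - f y - p) * γ (g x - g y - q) *
      (deriv f y * deriv g x - deriv f x * deriv g y) = ∫ y in c..d, -deriv g y * Ψx x y := by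
    intro x
    simp_rw [e x]
    have h1 : Continuous fun y => Ψx x y := cΨx.comp (Continuous.prodMk_right x)
    have h2 : Continuous fun y => Ψy x y := cΨy.comp (Continuous.prodMk_right x)
    rw [intervalIntegral.integral_sub (Continuous.intervalIntegrable (by fun_prop) _ _)
      (Continuous.intervalIntegrable (by fun_prop) _ _), intervalIntegral.integral_const_mul, iy]
    simp
  simp_rw [e2]
  -- After the swap the inner integral runs over `x`, where `Ψx` is a derivative.
  rw [intervalIntegral_intervalIntegral_swap]
  · simp [intervalIntegral.integral_const_mul, ix]
  · have : Continuous (Function.uncurry fun x y => -deriv g y * Ψx x y) := by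
      have : (Function.uncurry fun x y => -deriv g y * Ψx x y) =
        fun z : ℝ × ℝ => -deriv g z.2 * Function.uncurry Ψx z := rfl
      rw [this]; fun_prop
    exact (this.continuousOn.integrableOn_compact (isCompact_uIcc.prod isCompact_uIcc)).mono_set
      (prod_mono uIoc_subset_uIcc uIoc_subset_uIcc)

/-- Modulo 2 both signs equal 1, so the sum reduces to the cardinality. -/
theorem even_card_of_sum_sign_eq_zero {ι : Type*} (Z : Finset ι) (σ : ι → ℤ)
    (hσ : ∀ i ∈ Z, σ i = 1 ∨ σ i = -1) (h : ∑ i ∈ Z, σ i = 0) : Even Z.card := by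
  rw [← ZMod.natCast_eq_zero_iff_even]
  have h2 : ∑ i ∈ Z, ((σ i : ℤ) : ZMod 2) = 0 := by exact_mod_cast congrArg (Int.cast : ℤ → ZMod 2) h
  rw [Finset.sum_congr rfl (g := fun _ => (1 : ZMod 2))] at h2
  · simpa using h2
  · intro i hi
    rcases hσ i hi with h | h <;> rw [h]
    · simp
    · decide

/-- A neighbourhood on which a `C¹` map is injective with Jacobian of constant sign. -/
theorem exists_isOpen_injOn_det_sign {F : ℝ × ℝ → ℝ × ℝ} {F' : ℝ × ℝ → (ℝ × ℝ →L[ℝ] ℝ × ℝ)}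
    (hF : ∀ z, HasFDerivAt F (F' z) z) (hF' : Continuous F') {z : ℝ × ℝ} (hz : (F' z).det ≠ 0)
    {W : Set (ℝ × ℝ)} (hW : W ∈ 𝓝 z) :
    ∃ U ⊆ W, IsOpen U ∧ z ∈ U ∧ InjOn F U ∧ F '' U ∈ 𝓝 (F z) ∧
      ∃ σ : ℤ, (σ = 1 ∨ σ = -1) ∧ ∀ w ∈ U, (F' w).det = σ * |(F' w).det| := by
  have hs : HasStrictFDerivAt F
      (((F' z).toContinuousLinearEquivOfDetNeZero hz : (ℝ × ℝ) ≃L[ℝ] (ℝ × ℝ)) :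
        ℝ × ℝ →L[ℝ] ℝ × ℝ) z := by
    rw [ContinuousLinearMap.coe_toContinuousLinearEquivOfDetNeZero]
    exact hasStrictFDerivAt_of_hasFDerivAt_of_continuousAt (Eventually.of_forall hF)
      hF'.continuousAt
  have cdet : Continuous fun w => (F' w).det := ContinuousLinearMap.continuous_det.comp hF'
  obtain ⟨σ, hσ, O, hO, hzO, hdet⟩ : ∃ σ : ℤ, (σ = 1 ∨ σ = -1) ∧ ∃ O : Set (ℝ × ℝ), IsOpen O ∧
      z ∈ O ∧ ∀ w ∈ O, (F' w).det = σ * |(F' w).det| := by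
    rcases lt_or_gt_of_ne hz with h | h
    · refine ⟨-1, Or.inr rfl, _, isOpen_lt cdet continuous_const, h, fun w hw => ?_⟩
      rw [abs_of_neg hw]; simp
    · refine ⟨1, Or.inl rfl, _, isOpen_lt continuous_const cdet, h, fun w hw => ?_⟩
      rw [abs_of_pos hw]; simp
  set e := hs.toOpenPartialHomeomorph F
  have hopen : IsOpen (e.source ∩ O ∩ interior W) :=
    (e.open_source.inter hO).inter isOpen_interior
  have hmem : z ∈ e.source ∩ O ∩ interior W :=
    ⟨⟨hs.mem_toOpenPartialHomeomorph_source, hzO⟩, mem_interior_iff_mem_nhds.2 hW⟩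
  refine ⟨e.source ∩ O ∩ interior W, fun w hw => interior_subset hw.2, hopen, hmem,
    fun a ha b hb => e.injOn ha.1.1 hb.1.1, ?_, σ, hσ, fun w hw => hdet w hw.1.2⟩
  rw [← hs.map_nhds_eq_of_equiv]
  exact image_mem_map (hopen.mem_nhds hmem)

/-- A `C¹` map of degree zero, the degree being computed by integration over the compact set `K`,
has an even number of zeros, provided that they are nondegenerate except for those in a set `V`
whose image in `K` misses an open set `Q` adherent to `0`. -/
theorem even_card_zeros_of_integral_eq_zero {F : ℝ × ℝ → ℝ × ℝ}
    {F' : ℝ × ℝ → (ℝ × ℝ →L[ℝ] ℝ × ℝ)}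
    (hF : ∀ z, HasFDerivAt F (F' z) z) (hF' : Continuous F') {K : Set (ℝ × ℝ)} (hK : IsCompact K)
    (Z : Finset (ℝ × ℝ)) (hZK : ∀ z ∈ Z, K ∈ 𝓝 z) (hZ0 : ∀ z ∈ Z, F z = 0)
    (hdet : ∀ z ∈ Z, (F' z).det ≠ 0) {V Q : Set (ℝ × ℝ)} (hV : IsOpen V)
    (hZV : ∀ z ∈ K, F z = 0 → z ∈ Z ∨ z ∈ V) (hQ : IsOpen Q) (hQ0 : (0 : ℝ × ℝ) ∈ closure Q)
    (hVQ : ∀ z ∈ K, z ∈ V → F z ∉ Q)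
    (hint : ∀ β : ℝ → ℝ, ContDiff ℝ 1 β → ∀ q : ℝ × ℝ,
      ∫ z in K, β ((F z).1 - q.1) * β ((F z).2 - q.2) * (F' z).det = 0) : Even Z.card := by
  have cF : Continuous F := continuous_iff_continuousAt.2 fun z => (hF z).continuousAt
  have cdet : Continuous fun w => (F' w).det := ContinuousLinearMap.continuous_det.comp hF'
  obtain ⟨W, hW, hWd⟩ := Z.finite_toSet.t2_separation
  -- Outside `Z` the values `∅` and `1` are placeholders that make `U` and `σ` total functions.
  have hex : ∀ z, ∃ U : Set (ℝ × ℝ), ∃ σ : ℤ, z ∈ Z → U ⊆ K ∩ W z ∧ IsOpen U ∧ z ∈ U ∧ InjOn F U ∧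
      F '' U ∈ 𝓝 (0 : ℝ × ℝ) ∧ (σ = 1 ∨ σ = -1) ∧ ∀ w ∈ U, (F' w).det = σ * |(F' w).det| := by
    intro z
    by_cases hz : z ∈ Z
    · obtain ⟨U, h1, h2, h3, h4, h5, σ, h6, h7⟩ := exists_isOpen_injOn_det_sign hF hF' (hdet z hz)
        (inter_mem (hZK z hz) ((hW z).2.mem_nhds (hW z).1))
      exact ⟨U, σ, fun _ => ⟨h1, h2, h3, h4, hZ0 z hz ▸ h5, h6, h7⟩⟩
    · exact ⟨∅, 1, fun h => absurd h hz⟩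
  choose U σ hU using hex
  have hdisj : (Z : Set (ℝ × ℝ)).PairwiseDisjoint U := fun a ha b hb hab =>
    (hWd ha hb hab).mono (fun _ h => ((hU a ha).1 h).2) (fun _ h => ((hU b hb).1 h).2)
  have hUo : IsOpen (⋃ z ∈ Z, U z) := isOpen_biUnion fun z hz => (hU z hz).2.1
  have hUK : (⋃ z ∈ Z, U z) ⊆ K := iUnion₂_subset fun z hz _ h => ((hU z hz).1 h).1
  -- the values avoided far from the zeros
  have hK' : IsCompact (F '' (K \ (V ∪ ⋃ z ∈ Z, U z))) := (hK.diff (hV.union hUo)).image cF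
  have hN : ((F '' (K \ (V ∪ ⋃ z ∈ Z, U z)))ᶜ ∩ ⋂ z ∈ Z, F '' U z) ∈ 𝓝 (0 : ℝ × ℝ) := by
    refine inter_mem (hK'.isClosed.isOpen_compl.mem_nhds ?_)
      ((Filter.biInter_finset_mem Z).2 fun z hz => (hU z hz).2.2.2.2.1)
    rintro ⟨z, ⟨hz, hz'⟩, h0⟩
    rcases hZV z hz h0 with h | h
    · exact hz' (Or.inr (mem_biUnion h (hU z h).2.2.1))
    · exact hz' (Or.inl h)
  -- The degree is evaluated at `q` instead of `0`: close enough to `0` to be taken in every `U z`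
  -- and nowhere else outside `V`, and in `Q`, so not taken in `V` either.
  obtain ⟨q, hqN, hqQ⟩ := mem_closure_iff_nhds.1 hQ0 _ (interior_mem_nhds.2 hN)
  obtain ⟨δ, hδ, hball⟩ := Metric.isOpen_iff.1 (isOpen_interior.inter hQ) q ⟨hqN, hqQ⟩
  set b : ContDiffBump (0 : ℝ) := ⟨δ / 2, δ, half_pos hδ, half_lt_self hδ⟩ with hb
  set β : ℝ → ℝ := b.normed volume with hβ
  have cβ : ContDiff ℝ 1 β := b.contDiff_normed
  have iβ : ∫ x, β x = 1 := b.integral_normed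
  have sβ : ∀ x, β x ≠ 0 → |x| < δ := by
    intro x hx
    have : x ∈ Function.support (b.normed volume) := hx
    rw [b.support_normed_eq] at this
    simpa using this
  -- The norm on `ℝ × ℝ` is the maximum norm, so a product of two bumps of radius `δ` is supported
  -- in the ball of radius `δ`.
  set φ : ℝ × ℝ → ℝ := fun p => β (p.1 - q.1) * β (p.2 - q.2) with hφ
  have cφ : Continuous φ := by
    have := cβ.continuous
    simp only [hφ]; fun_prop
  have sφ : ∀ p, φ p ≠ 0 → p ∈ Metric.ball q δ := by
    intro p hp
    have h1 := sβ _ (left_ne_zero_of_mul hp)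
    have h2 := sβ _ (right_ne_zero_of_mul hp)
    rw [Metric.mem_ball, Prod.dist_eq]
    exact max_lt h1 h2
  have iφ : ∫ p, φ p = 1 := by
    have h := integral_prod_mul (μ := (volume : Measure ℝ)) (ν := (volume : Measure ℝ))
      (fun x => β (x - q.1)) (fun x => β (x - q.2))
    rw [integral_sub_right_eq_self, integral_sub_right_eq_self, iβ, one_mul] at h
    exact h
  have hloc : ∀ z ∈ Z, ∫ w in U z, φ (F w) * (F' w).det = σ z := by
    intro z hz
    obtain ⟨-, ho, -, hinj, -, -, hs⟩ := hU z hz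
    have h1 := integral_image_eq_integral_abs_det_fderiv_smul volume ho.measurableSet
      (fun w _ => (hF w).hasFDerivWithinAt) hinj φ
    -- The bump lives inside `F '' U z`, so its integral over this image is its total mass 1.
    rw [setIntegral_eq_integral_of_forall_compl_eq_zero, iφ] at h1
    · calc ∫ w in U z, φ (F w) * (F' w).det
          = ∫ w in U z, (σ z : ℝ) * (|(F' w).det| • φ (F w)) := by
            refine setIntegral_congr_fun ho.measurableSet fun w hw => ?_
            simp only [smul_eq_mul]
            rw [hs w hw, abs_mul, abs_abs]
            rcases (hU z hz).2.2.2.2.2.1 with h | h <;> rw [h] <;> simp <;> ring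
        _ = σ z := by rw [integral_const_mul, ← h1, mul_one]
    · intro p hp
      by_contra hne
      have := interior_subset (hball (sφ p hne)).1
      exact hp (mem_iInter₂.1 this.2 z hz)
  have hsum : ∫ z in K, φ (F z) * (F' z).det = 0 := hint β cβ q
  -- The integrand vanishes on `K` off the sets `U z`, so the integral is the sum of the local
  -- signs.
  rw [setIntegral_eq_of_subset_of_forall_sdiff_eq_zero hK.measurableSet hUK,
    integral_biUnion_finset Z (fun z hz => (hU z hz).2.1.measurableSet) hdisj,
    Finset.sum_congr rfl hloc] at hsum
  · exact even_card_of_sum_sign_eq_zero Z σ (fun z hz => (hU z hz).2.2.2.2.2.1)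
      (by exact_mod_cast hsum)
  · intro z hz
    have : Continuous fun z => φ (F z) * (F' z).det := by fun_prop
    exact (this.continuousOn.integrableOn_compact hK).mono_set fun _ h => ((hU z hz).1 h).1
  · intro z hz
    by_contra hne
    have hne' : φ (F z) ≠ 0 := left_ne_zero_of_mul hne
    have hm := hball (sφ _ hne')
    by_cases hzV : z ∈ V
    · exact hVQ z hz.1 hzV hm.2
    · exact (interior_subset hm.1).1 ⟨z, ⟨hz.1, fun h => h.elim hzV hz.2⟩, rfl⟩

theorem det_prod_fst_snd (a b c d : ℝ) :
    (((a • ContinuousLinearMap.fst ℝ ℝ ℝ + b • ContinuousLinearMap.snd ℝ ℝ ℝ).prod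
      (c • ContinuousLinearMap.fst ℝ ℝ ℝ + d • ContinuousLinearMap.snd ℝ ℝ ℝ)) :
      ℝ × ℝ →L[ℝ] ℝ × ℝ).det = a * d - b * c := by
  rw [ContinuousLinearMap.det, ← LinearMap.det_toMatrix (Module.Basis.finTwoProd ℝ),
    Matrix.det_fin_two]
  simp [LinearMap.toMatrix_apply]

/-- Two closed curves in the plane meet in an even number of points, if they meet transversally
outside of a set `V` of parameters for which the difference of the two curves misses an open set
`Q` adherent to `0`. -/
theorem even_card_intersections {f g : ℝ → ℝ} (hf : ContDiff ℝ 1 f) (hg : ContDiff ℝ 1 g)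
    {s t c d : ℝ} (hst : s ≤ t) (hcd : c ≤ d)
    (hfst : f s = f t) (hgst : g s = g t) (hfcd : f c = f d) (hgcd : g c = g d)
    (Z : Finset (ℝ × ℝ)) (hZ : ∀ z ∈ Z, z.1 ∈ Ioo s t ∧ z.2 ∈ Ioo c d ∧ f z.1 = f z.2 ∧
      g z.1 = g z.2 ∧ deriv f z.1 * deriv g z.2 - deriv g z.1 * deriv f z.2 ≠ 0)
    {V Q : Set (ℝ × ℝ)} (hV : IsOpen V)
    (hZV : ∀ x ∈ Icc s t, ∀ y ∈ Icc c d, f x = f y → g x = g y → (x, y) ∈ Z ∨ (x, y) ∈ V)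
    (hQ : IsOpen Q) (hQ0 : (0 : ℝ × ℝ) ∈ closure Q)
    (hVQ : ∀ x ∈ Icc s t, ∀ y ∈ Icc c d, (x, y) ∈ V → (f x - f y, g x - g y) ∉ Q) :
    Even Z.card := by
  have hf' : ∀ x, HasDerivAt f (deriv f x) x := fun x =>
    (hf.differentiable (by norm_num) x).hasDerivAt
  have hg' : ∀ x, HasDerivAt g (deriv g x) x := fun x =>
    (hg.differentiable (by norm_num) x).hasDerivAt
  have cf' : Continuous (deriv f) := hf.continuous_deriv (by norm_num)
  have cg' : Continuous (deriv g) := hg.continuous_deriv (by norm_num)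
  have aux : ∀ {k : ℝ → ℝ}, (∀ x, HasDerivAt k (deriv k x) x) → ∀ z : ℝ × ℝ,
      HasFDerivAt (fun z : ℝ × ℝ => k z.1 - k z.2) (deriv k z.1 • ContinuousLinearMap.fst ℝ ℝ ℝ +
        (-deriv k z.2) • ContinuousLinearMap.snd ℝ ℝ ℝ) z := by
    intro k hk z
    refine (((hk z.1).comp_hasFDerivAt z hasFDerivAt_fst).sub
      ((hk z.2).comp_hasFDerivAt z hasFDerivAt_snd)).congr_fderiv ?_
    ext <;> simp
  refine even_card_zeros_of_integral_eq_zero (K := Icc s t ×ˢ Icc c d)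
    (F := fun z => (f z.1 - f z.2, g z.1 - g z.2))
    (fun z => (aux hf' z).prodMk (aux hg' z)) ?_ (isCompact_Icc.prod isCompact_Icc) Z ?_ ?_ ?_
    hV ?_ hQ hQ0 ?_ ?_
  · exact (ContinuousLinearMap.prodₗᵢ ℝ).continuous.comp
      (Continuous.prodMk (by fun_prop) (by fun_prop))
  · intro z hz
    exact prod_mem_nhds (Icc_mem_nhds (hZ z hz).1.1 (hZ z hz).1.2)
      (Icc_mem_nhds (hZ z hz).2.1.1 (hZ z hz).2.1.2)
  · intro z hz
    obtain ⟨-, -, h1, h2, -⟩ := hZ z hz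
    simp [h1, h2]
  · intro z hz
    rw [det_prod_fst_snd]
    intro h
    refine (hZ z hz).2.2.2.2 ?_
    linarith
  · rintro ⟨x, y⟩ ⟨hx, hy⟩ h
    rw [Prod.mk_eq_zero, sub_eq_zero, sub_eq_zero] at h
    exact hZV x hx y hy h.1 h.2
  · rintro ⟨x, y⟩ ⟨hx, hy⟩ h
    exact hVQ x hx y hy h
  · intro β hβ q
    have h0 := integral_diff_pullback_eq_zero hf hg hβ.continuous hβ hfst hgst hfcd hgcd q.1 q.2
    simp_rw [det_prod_fst_snd]
    rw [Measure.volume_eq_prod, setIntegral_prod]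
    · rw [integral_Icc_eq_integral_Ioc, ← intervalIntegral.integral_of_le hst]
      rw [← h0]
      congr 1
      ext x
      rw [integral_Icc_eq_integral_Ioc, ← intervalIntegral.integral_of_le hcd]
      congr 1
      ext y
      ring
    · have := hβ.continuous
      have := hf.continuous
      have := hg.continuous
      exact (Continuous.continuousOn (by fun_prop)).integrableOn_compact
        (isCompact_Icc.prod isCompact_Icc)

/-! ### Intersections of two closed subarcs of a plane curve. -/

namespace PlaneCurve

/-- The coordinates of a plane curve as functions of a real parameter. -/
noncomputable def coord (C : PlaneCurve) (i : Fin 2) (t : ℝ) : ℝ := C.toFun (t : UnitAddCircle) i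

variable (C : PlaneCurve)

theorem contDiff_coord (i : Fin 2) : ContDiff ℝ 1 (C.coord i) :=
  contDiff_euclidean.1 C.contDiff i

theorem deriv_coord (i : Fin 2) (t : ℝ) :
    deriv (C.coord i) t = deriv (fun t : ℝ => C.toFun (t : UnitAddCircle)) t i := by
  have h := (C.contDiff.differentiable (by norm_num) t).hasDerivAt
  exact (((EuclideanSpace.proj (𝕜 := ℝ) i).hasFDerivAt.comp_hasDerivAt t h)).deriv

theorem toFun_eq_iff (s t : ℝ) : C.toFun (s : UnitAddCircle) = C.toFun (t : UnitAddCircle) ↔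
    C.coord 0 s = C.coord 0 t ∧ C.coord 1 s = C.coord 1 t := by
  constructor
  · intro h; simp [coord, h]
  · rintro ⟨h0, h1⟩
    ext i
    fin_cases i
    · exact h0
    · exact h1

theorem det_deriv_coord_ne_zero {s t : ℝ} (hst : (s : UnitAddCircle) ≠ t)
    (h : C.toFun (s : UnitAddCircle) = C.toFun (t : UnitAddCircle)) :
    deriv (C.coord 0) s * deriv (C.coord 1) t - deriv (C.coord 1) s * deriv (C.coord 0) t ≠ 0 := by
  have hli := LinearIndependent.pair_iff.1 (C.transversal s t hst h)
  simp only [deriv_coord]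
  set u := deriv (fun t : ℝ => C.toFun (t : UnitAddCircle)) s
  set v := deriv (fun t : ℝ => C.toFun (t : UnitAddCircle)) t
  intro h0
  -- The vector `v i • u - u i • v` has components 0 and ± the determinant, so it vanishes and
  -- independence forces its coefficients to be zero.
  have key : ∀ i, v i = 0 := by
    intro i
    refine (hli (v i) (-u i) ?_).1
    ext j
    fin_cases i <;> fin_cases j <;> simp <;> linarith
  have := (hli 0 1 (by ext j; simp [key j])).2
  exact one_ne_zero this

theorem coord_add_one (i : Fin 2) (t : ℝ) : C.coord i (t + 1) = C.coord i t := by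
  simp [coord]

theorem eq_or_eq_of_toFun_eq {x y z : UnitAddCircle} (hyz : y ≠ z) (h : C.toFun y = C.toFun z)
    (hx : C.toFun x = C.toFun y) : x = y ∨ x = z := by
  rcases C.no_triple x y z hx h with h | h | h
  · exact Or.inl h
  · exact absurd h hyz
  · exact Or.inr h

/-- The pairs of parameters in two given intervals at which the curve has a double point. -/
def crossingParams (C : PlaneCurve) (s t c d : ℝ) : Set (ℝ × ℝ) :=
  {z | z.1 ∈ Ioo s t ∧ z.2 ∈ Ioo c d ∧
    C.toFun (z.1 : UnitAddCircle) = C.toFun (z.2 : UnitAddCircle)}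

theorem coe_ne_coe_of_mem_Ioo {s t c d x y : ℝ} (htc : t ≤ c) (hds : d ≤ s + 1) (hx : x ∈ Ioo s t)
    (hy : y ∈ Ioo c d) : (x : UnitAddCircle) ≠ y := by
  intro h
  have := coe_inj_of_mem_Ico (s := s) ⟨hx.1.le, by linarith [hx.2, hy.1, hy.2]⟩
    ⟨by linarith [hx.1, hx.2, hy.1], by linarith [hy.2]⟩ h
  linarith [hx.2, hy.1]

theorem injOn_coe_crossingParams {s t c d : ℝ} (hst : s < t) (hcd : c < d) (htc : t ≤ c)
    (hds : d ≤ s + 1) : InjOn (fun z : ℝ × ℝ => ((z.1 : UnitAddCircle), (z.2 : UnitAddCircle)))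
      (C.crossingParams s t c d) := by
  rintro ⟨x, y⟩ ⟨hx, hy, -⟩ ⟨x', y'⟩ ⟨hx', hy', -⟩ h
  simp only [Prod.mk.injEq] at h hx hy hx' hy' ⊢
  exact ⟨coe_inj_of_mem_Ico (s := s) ⟨hx.1.le, by linarith [hx.2]⟩
      ⟨hx'.1.le, by linarith [hx'.2]⟩ h.1,
    coe_inj_of_mem_Ico (s := s) ⟨by linarith [hy.1], by linarith [hy.2]⟩
      ⟨by linarith [hy'.1], by linarith [hy'.2]⟩ h.2⟩

theorem finite_crossingParams {s t c d : ℝ} (hst : s < t) (hcd : c < d) (htc : t ≤ c)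
    (hds : d ≤ s + 1) : (C.crossingParams s t c d).Finite := by
  refine Finite.of_finite_image (C.finite_doublePairs.subset ?_)
    (C.injOn_coe_crossingParams hst hcd htc hds)
  rintro _ ⟨z, ⟨hx, hy, h⟩, rfl⟩
  exact ⟨coe_ne_coe_of_mem_Ioo htc hds hx hy, h⟩

/-- Two closed subarcs of a plane curve cross in an even number of points, apart from a set `V` of
parameters as in `even_card_intersections`. -/
theorem even_ncard_crossingParams {s t c d : ℝ} (hst : s < t) (hcd : c < d) (htc : t ≤ c)
    (hds : d ≤ s + 1) (hCst : C.toFun (s : UnitAddCircle) = C.toFun (t : UnitAddCircle))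
    (hCcd : C.toFun (c : UnitAddCircle) = C.toFun (d : UnitAddCircle))
    {V Q : Set (ℝ × ℝ)} (hV : IsOpen V)
    (hZV : ∀ x ∈ Icc s t, ∀ y ∈ Icc c d,
      C.toFun (x : UnitAddCircle) = C.toFun (y : UnitAddCircle) →
      (x, y) ∈ C.crossingParams s t c d ∨ (x, y) ∈ V)
    (hQ : IsOpen Q) (hQ0 : (0 : ℝ × ℝ) ∈ closure Q)
    (hVQ : ∀ x ∈ Icc s t, ∀ y ∈ Icc c d, (x, y) ∈ V →
      (C.coord 0 x - C.coord 0 y, C.coord 1 x - C.coord 1 y) ∉ Q) :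
    Even (C.crossingParams s t c d).ncard := by
  have hfin := C.finite_crossingParams hst hcd htc hds
  rw [ncard_eq_toFinset_card _ hfin]
  rw [toFun_eq_iff] at hCst hCcd
  refine even_card_intersections (C.contDiff_coord 0) (C.contDiff_coord 1) hst.le hcd.le
    hCst.1 hCst.2 hCcd.1 hCcd.2 _ ?_ hV ?_ hQ hQ0 hVQ
  · intro z hz
    obtain ⟨hx, hy, h⟩ := hfin.mem_toFinset.1 hz
    exact ⟨hx, hy, ((C.toFun_eq_iff _ _).1 h).1, ((C.toFun_eq_iff _ _).1 h).2,
      C.det_deriv_coord_ne_zero (coe_ne_coe_of_mem_Ioo htc hds hx hy) h⟩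
  · intro x hx y hy h0 h1
    rw [hfin.mem_toFinset]
    exact hZV x hx y hy ((C.toFun_eq_iff _ _).2 ⟨h0, h1⟩)

/-- Two closed subarcs without common parameters cross in an even number of points. -/
theorem even_ncard_crossingParams_of_lt {s t c d : ℝ} (hst : s < t) (hcd : c < d) (htc : t < c)
    (hds : d < s + 1) (hCst : C.toFun (s : UnitAddCircle) = C.toFun (t : UnitAddCircle))
    (hCcd : C.toFun (c : UnitAddCircle) = C.toFun (d : UnitAddCircle)) :
    Even (C.crossingParams s t c d).ncard := by
  have inj : ∀ {x y : ℝ}, x ∈ Ico s (s + 1) → y ∈ Ico s (s + 1) → (x : UnitAddCircle) = y → x = y :=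
    coe_inj_of_mem_Ico
  have ms : s ∈ Ico s (s + 1) := ⟨le_rfl, by linarith⟩
  have mt : t ∈ Ico s (s + 1) := ⟨by linarith, by linarith⟩
  have mc : c ∈ Ico s (s + 1) := ⟨by linarith, by linarith⟩
  have md : d ∈ Ico s (s + 1) := ⟨by linarith, by linarith⟩
  -- No zero lies on the boundary of the rectangle, so nothing has to be discarded.
  refine C.even_ncard_crossingParams hst hcd htc.le hds.le hCst hCcd (V := ∅) (Q := univ)
    isOpen_empty ?_ isOpen_univ (by simp) (by simp)
  intro x hx y hy h
  have mx : x ∈ Ico s (s + 1) := ⟨hx.1, by linarith [hx.2]⟩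
  have my : y ∈ Ico s (s + 1) := ⟨by linarith [hy.1], by linarith [hy.2]⟩
  have hy' : y ≠ s ∧ y ≠ t := ⟨(hst.trans (htc.trans_le hy.1)).ne', (htc.trans_le hy.1).ne'⟩
  have hx' : x ≠ c ∧ x ≠ d := ⟨(hx.2.trans_lt htc).ne, (hx.2.trans_lt (htc.trans hcd)).ne⟩
  -- A point of one arc lying over the base point of the other would be a third preimage of a double
  -- point.
  have kx : ¬ (C.toFun (y : UnitAddCircle) = C.toFun (s : UnitAddCircle)) := fun hys => by
    rcases C.eq_or_eq_of_toFun_eq (fun h => hst.ne (inj ms mt h)) hCst hys with h | h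
    · exact hy'.1 (inj my ms h)
    · exact hy'.2 (inj my mt h)
  have ky : ¬ (C.toFun (x : UnitAddCircle) = C.toFun (c : UnitAddCircle)) := fun hxc => by
    rcases C.eq_or_eq_of_toFun_eq (fun h => hcd.ne (inj mc md h)) hCcd hxc with h | h
    · exact hx'.1 (inj mx mc h)
    · exact hx'.2 (inj mx md h)
  refine Or.inl ⟨⟨lt_of_le_of_ne hx.1 ?_, lt_of_le_of_ne hx.2 ?_⟩,
    ⟨lt_of_le_of_ne hy.1 ?_, lt_of_le_of_ne hy.2 ?_⟩, h⟩
  · rintro rfl; exact kx h.symm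
  · rintro rfl; exact kx (h.symm.trans hCst.symm)
  · rintro rfl; exact ky h
  · rintro rfl; exact ky (h.trans hCcd.symm)

theorem deriv_coord_add_one (i : Fin 2) (t : ℝ) :
    deriv (C.coord i) (t + 1) = deriv (C.coord i) t := by
  rw [← deriv_comp_add_const]
  simp_rw [coord_add_one]

/-- The two closed subarcs into which a double point divides the curve cross in an even number of
points. -/
theorem even_ncard_crossingParams_complement {s t : ℝ} (hst : s < t) (hts : t < s + 1)
    (hC : C.toFun (s : UnitAddCircle) = C.toFun (t : UnitAddCircle)) :
    Even (C.crossingParams s t t (s + 1)).ncard := by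
  have inj : ∀ {x y : ℝ}, x ∈ Ico s (s + 1) → y ∈ Ico s (s + 1) → (x : UnitAddCircle) = y → x = y :=
    coe_inj_of_mem_Ico
  have ms : s ∈ Ico s (s + 1) := ⟨le_rfl, by linarith⟩
  have mt : t ∈ Ico s (s + 1) := ⟨by linarith, by linarith⟩
  have hne : (s : UnitAddCircle) ≠ t := fun h => hst.ne (inj ms mt h)
  have es : ((s + 1 : ℝ) : UnitAddCircle) = s := AddCircle.coe_add_period 1 s
  have hdet := C.det_deriv_coord_ne_zero hne hC
  have hCc := (C.toFun_eq_iff _ _).1 hC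
  set D := deriv (C.coord 0) s * deriv (C.coord 1) t - deriv (C.coord 1) s * deriv (C.coord 0) t
    with hD
  -- With `u`, `v` the velocities at `s`, `t` and `D = det(u, v)`, the functional `(α, β)` is `w ↦ D
  -- · det(w, u + v)`. It takes the values `D²` on `u` and `-D²` on `v`.
  set α := D * (deriv (C.coord 1) t + deriv (C.coord 1) s) with hα
  set β := -D * (deriv (C.coord 0) t + deriv (C.coord 0) s) with hβ
  set h : ℝ → ℝ := fun x =>
    α * (C.coord 0 x - C.coord 0 s) + β * (C.coord 1 x - C.coord 1 s) with hh
  have hd : ∀ x, deriv h x = α * deriv (C.coord 0) x + β * deriv (C.coord 1) x := fun x =>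
    (((((C.contDiff_coord 0).differentiable (by norm_num) x).hasDerivAt.sub_const _).const_mul
      α).add ((((C.contDiff_coord 1).differentiable (by norm_num) x).hasDerivAt.sub_const
      _).const_mul β)).deriv
  have hD2 : 0 < D ^ 2 := by positivity
  have ds : 0 < deriv h s := by
    rw [hd]
    convert hD2 using 1
    simp only [hα, hβ]; rw [hD]; ring
  have dt : deriv h t < 0 := by
    rw [hd, ← neg_pos]
    convert hD2 using 1
    simp only [hα, hβ]; rw [hD]; ring
  have ds1 : 0 < deriv h (s + 1) := by
    rw [hd, deriv_coord_add_one, deriv_coord_add_one, ← hd]; exact ds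
  have hs : h s = 0 := by simp [hh]
  have ht : h t = 0 := by simp [hh, hCc]
  have hs1 : h (s + 1) = 0 := by simp [hh, coord_add_one]
  obtain ⟨A₁, pA₁, oA₁, sA₁⟩ := eventually_nhds_iff.1
    (eventually_nhdsWithin_sign_eq_of_deriv_pos ds hs)
  obtain ⟨A₂, pA₂, oA₂, tA₂⟩ := eventually_nhds_iff.1
    (eventually_nhdsWithin_sign_eq_of_deriv_neg dt ht)
  obtain ⟨A₃, pA₃, oA₃, sA₃⟩ := eventually_nhds_iff.1
    (eventually_nhdsWithin_sign_eq_of_deriv_pos ds1 hs1)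
  -- Near the double point the arc over `[s, t]` stays in `h ≥ 0` and the arc over `[t, s + 1]` in
  -- `h ≤ 0`. The difference of the two arcs therefore misses the half-plane `Q` for parameters near
  -- the corners.
  refine C.even_ncard_crossingParams hst hts le_rfl le_rfl hC (by rw [es, hC])
    (V := (A₁ ∪ A₂) ×ˢ (A₂ ∪ A₃)) (Q := {q | α * q.1 + β * q.2 < 0})
    ((oA₁.union oA₂).prod (oA₂.union oA₃)) ?_ (isOpen_lt (by fun_prop) (by fun_prop)) ?_ ?_
  · intro x hx y hy hxy
    have hxs : x = s ∨ x = t ∨ x ∈ Ioo s t := by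
      rcases hx.1.eq_or_lt with h | h
      · exact Or.inl h.symm
      · exact Or.inr (hx.2.eq_or_lt.imp id fun h' => ⟨h, h'⟩)
    have hys : y = t ∨ y = s + 1 ∨ y ∈ Ioo t (s + 1) := by
      rcases hy.1.eq_or_lt with h | h
      · exact Or.inl h.symm
      · exact Or.inr (hy.2.eq_or_lt.imp id fun h' => ⟨h, h'⟩)
    have kx : C.toFun (x : UnitAddCircle) = C.toFun (s : UnitAddCircle) → x = s ∨ x = t := by
      intro h
      have mx : x ∈ Ico s (s + 1) := ⟨hx.1, by linarith [hx.2]⟩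
      exact (C.eq_or_eq_of_toFun_eq hne hC h).imp (inj mx ms) (inj mx mt)
    have ky : C.toFun (y : UnitAddCircle) = C.toFun (s : UnitAddCircle) → y = t ∨ y = s + 1 := by
      intro h
      rcases hy.2.eq_or_lt with h' | h'
      · exact Or.inr h'
      · have my : y ∈ Ico s (s + 1) := ⟨by linarith [hy.1], h'⟩
        rcases C.eq_or_eq_of_toFun_eq hne hC h with h | h
        · exact absurd (inj my ms h) (hst.trans_le hy.1).ne'
        · exact Or.inl (inj my mt h)
    have corner : (x = s ∨ x = t) → (y = t ∨ y = s + 1) → (x, y) ∈ (A₁ ∪ A₂) ×ˢ (A₂ ∪ A₃) := by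
      intro h1 h2
      constructor
      · rcases h1 with h | h
        · exact Or.inl (by rw [h]; exact sA₁)
        · exact Or.inr (by rw [h]; exact tA₂)
      · rcases h2 with h | h
        · exact Or.inl (by rw [h]; exact tA₂)
        · exact Or.inr (by rw [h]; exact sA₃)
    by_cases hxy' : x ∈ Ioo s t ∧ y ∈ Ioo t (s + 1)
    · exact Or.inl ⟨hxy'.1, hxy'.2, hxy⟩
    -- A zero on the boundary lies over the double point, which has no third preimage, so it is a
    -- corner.
    · right
      have hx1 : C.toFun (x : UnitAddCircle) = C.toFun (s : UnitAddCircle) := by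
        rcases hxs with rfl | rfl | hx'
        · rfl
        · exact hC.symm
        · rcases hys with rfl | rfl | hy'
          · exact hxy.trans hC.symm
          · rw [hxy, es]
          · exact absurd ⟨hx', hy'⟩ hxy'
      exact corner (kx hx1) (ky (hxy.symm.trans hx1))
  -- The origin is approached inside `Q` along the ray spanned by `(-α, -β)`.
  · have hmem : ∀ r ∈ Ioi (0 : ℝ), r • ((-α, -β) : ℝ × ℝ) ∈ {q : ℝ × ℝ | α * q.1 + β * q.2 < 0} := by
      intro r hr
      have : α ≠ 0 ∨ β ≠ 0 := by
        by_contra! h0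
        rw [hd, h0.1, h0.2] at ds
        simp at ds
      have h2 : 0 < α ^ 2 + β ^ 2 := by rcases this with h | h <;> positivity
      have hr : 0 < r := hr
      simp only [Prod.smul_mk, smul_eq_mul, mem_ofPred_eq]
      nlinarith [mul_pos hr h2]
    have h0 : (0 : ℝ) ∈ closure (Ioi (0 : ℝ)) := by rw [closure_Ioi]; exact self_mem_Ici
    have := map_mem_closure (f := fun r : ℝ => r • ((-α, -β) : ℝ × ℝ)) (by fun_prop) h0 hmem
    simpa using this
  · rintro x hx y hy ⟨hxV, hyV⟩
    have h1 : 0 ≤ h x := by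
      rcases hxV with hx' | hx'
      · rw [← sign_nonneg_iff, pA₁ x hx', sign_nonneg_iff]; linarith [hx.1]
      · rw [← sign_nonneg_iff, pA₂ x hx', sign_nonneg_iff]; linarith [hx.2]
    have h2 : h y ≤ 0 := by
      rcases hyV with hy' | hy'
      · rw [← sign_nonpos_iff, pA₂ y hy', sign_nonpos_iff]; linarith [hy.1]
      · rw [← sign_nonpos_iff, pA₃ y hy', sign_nonpos_iff]; linarith [hy.2]
    simp only [hh] at h1 h2
    simp only [mem_ofPred_eq, not_lt]
    linarith

end PlaneCurve

/-! ### From crossing chords to intersections of subarcs. -/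

/-- Two chords without common endpoints that do not cross lie one after the other on the circle. -/
theorem exists_lifts_of_not_crosses {a b : Sym2 UnitAddCircle} (ha : ¬ a.IsDiag) (hb : ¬ b.IsDiag)
    (hab : ∀ x ∈ a, x ∉ b) (h : ¬ Crosses a b) :
    ∃ s t c d : ℝ, s < t ∧ t < c ∧ c < d ∧ d < s + 1 ∧
      a = s((s : UnitAddCircle), (t : UnitAddCircle)) ∧
      b = s((c : UnitAddCircle), (d : UnitAddCircle)) := by
  have order : ∀ {l u p q : ℝ}, p ≠ q → p ∈ Ioo l u → q ∈ Ioo l u →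
      ∃ c d : ℝ, l < c ∧ c < d ∧ d < u ∧
        s((p : UnitAddCircle), (q : UnitAddCircle)) = s((c : UnitAddCircle), (d : UnitAddCircle)) := by
    intro l u p q hpq hp hq
    rcases lt_or_gt_of_ne hpq with h | h
    · exact ⟨p, q, hp.1, h, hq.2, rfl⟩
    · exact ⟨q, p, hq.1, h, hp.2, Sym2.eq_swap⟩
  induction a with | _ a₁ a₂
  induction b with | _ b₁ b₂
  obtain ⟨s, t, hst, hts, rfl, rfl⟩ := exists_lift_pair (show a₁ ≠ a₂ by simpa using ha)
  obtain ⟨p, hp, rfl⟩ := exists_coe_eq_Ico s b₁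
  obtain ⟨q, hq, rfl⟩ := exists_coe_eq_Ico s b₂
  have hpq : p ≠ q := by rintro rfl; simp at hb
  have hs := hab s (by simp)
  have ht := hab t (by simp)
  have side : ∀ r ∈ Ico s (s + 1), r ≠ s → r ≠ t → r ∈ Ioo s t ∨ r ∈ Ioo t (s + 1) := by
    intro r hr h1 h2
    rcases lt_or_gt_of_ne h2 with h | h
    · exact Or.inl ⟨lt_of_le_of_ne hr.1 h1.symm, h⟩
    · exact Or.inr ⟨h, hr.2⟩
  rw [crosses_coe_iff hst hts] at h
  rcases side p hp (by rintro rfl; simp at hs) (by rintro rfl; simp at ht) with hp' | hp' <;>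
    rcases side q hq (by rintro rfl; simp at hs) (by rintro rfl; simp at ht) with hq' | hq'
  · obtain ⟨c, d, h1, h2, h3, h4⟩ := order hpq hp' hq'
    -- Both endpoints of `b` lie on the arc from `s` to `t`, so the complementary arc from `t` to `s
    -- + 1` is used for `a`, and the lifts of `b` move up by a period to follow it.
    refine ⟨t, s + 1, c + 1, d + 1, hts, by linarith, by linarith, by linarith, ?_, ?_⟩
    · rw [AddCircle.coe_add_period, Sym2.eq_swap]
    · rw [h4, AddCircle.coe_add_period, AddCircle.coe_add_period]
  · exact absurd ⟨p, hp', q, hq', rfl⟩ h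
  · exact absurd ⟨q, hq', p, hp', Sym2.eq_swap⟩ h
  · obtain ⟨c, d, h1, h2, h3, h4⟩ := order hpq hp' hq'
    exact ⟨s, t, c, d, hst, h1, h2, h3, rfl, h4⟩

namespace PlaneCurve

variable (C : PlaneCurve)

theorem mk_mem_chords_iff {x y : UnitAddCircle} :
    s(x, y) ∈ C.gaussDiagram.chords ↔ x ≠ y ∧ C.toFun x = C.toFun y := by
  constructor
  · rintro ⟨x', y', hne, h, he⟩
    rcases Sym2.eq_iff.1 he with ⟨rfl, rfl⟩ | ⟨rfl, rfl⟩
    · exact ⟨hne, h⟩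
    · exact ⟨hne.symm, h.symm⟩
  · rintro ⟨hne, h⟩
    exact ⟨x, y, hne, h, rfl⟩

/-- An unordered chord determines its parameters because the two parameter arcs are disjoint on the
circle, which rules out an exchange of endpoints. -/
theorem injOn_mk_crossingParams {s t c d : ℝ} (hst : s < t) (hcd : c < d) (htc : t ≤ c)
    (hds : d ≤ s + 1) :
    InjOn (fun z : ℝ × ℝ => s((z.1 : UnitAddCircle), (z.2 : UnitAddCircle)))
      (C.crossingParams s t c d) := by
  intro z hz z' hz' h
  refine C.injOn_coe_crossingParams hst hcd htc hds hz hz' ?_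
  rcases Sym2.eq_iff.1 h with h | h
  · exact Prod.ext h.1 h.2
  · exact absurd h.1 (coe_ne_coe_of_mem_Ioo htc hds hz.1 hz'.2.1)

theorem crossing_eq_image {s t : ℝ} (hst : s < t) (hts : t < s + 1) :
    C.gaussDiagram.crossing s((s : UnitAddCircle), (t : UnitAddCircle)) =
      (fun z : ℝ × ℝ => s((z.1 : UnitAddCircle), (z.2 : UnitAddCircle))) ''
        C.crossingParams s t t (s + 1) := by
  ext e
  constructor
  · rintro ⟨he, hc⟩
    obtain ⟨x, hx, y, hy, rfl⟩ := (crosses_coe_iff hst hts e).1 hc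
    exact ⟨(x, y), ⟨hx, hy, (C.mk_mem_chords_iff.1 he).2⟩, rfl⟩
  · rintro ⟨⟨x, y⟩, ⟨hx, hy, h⟩, rfl⟩
    exact ⟨C.mk_mem_chords_iff.2 ⟨coe_ne_coe_of_mem_Ioo le_rfl le_rfl hx hy, h⟩,
      (crosses_coe_iff hst hts _).2 ⟨x, hx, y, hy, rfl⟩⟩

/-- A chord crossing the first has exactly one endpoint over `(s, t)`; to cross the second it needs
one over `(c, d)`, and disjointness of the arcs makes this the other endpoint. -/
theorem crossing_inter_crossing_eq_image {s t c d : ℝ} (hst : s < t) (htc : t < c) (hcd : c < d)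
    (hds : d < s + 1) :
    C.gaussDiagram.crossing s((s : UnitAddCircle), (t : UnitAddCircle)) ∩
      C.gaussDiagram.crossing s((c : UnitAddCircle), (d : UnitAddCircle)) =
      (fun z : ℝ × ℝ => s((z.1 : UnitAddCircle), (z.2 : UnitAddCircle))) ''
        C.crossingParams s t c d := by
  have hts : t < s + 1 := by linarith
  have hdc : d < c + 1 := by linarith
  ext e
  constructor
  · rintro ⟨⟨he, hc⟩, ⟨-, hc'⟩⟩
    obtain ⟨x, hx, y, hy, rfl⟩ := (crosses_coe_iff hst hts e).1 hc
    obtain ⟨x', hx', y', hy', h⟩ := (crosses_coe_iff hcd hdc _).1 hc'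
    rcases Sym2.eq_iff.1 h with h | h
    · exact absurd h.1 (coe_ne_coe_of_mem_Ioo htc.le hds.le hx hx')
    · have : y = x' := coe_inj_of_mem_Ico (s := s) ⟨by linarith [hy.1], hy.2⟩
        ⟨by linarith [hx'.1], by linarith [hx'.2]⟩ h.2
      subst this
      exact ⟨(x, y), ⟨hx, hx', (C.mk_mem_chords_iff.1 he).2⟩, rfl⟩
  · rintro ⟨⟨x, y⟩, ⟨hx, hy, h⟩, rfl⟩
    simp only at hx hy h
    have hm := C.mk_mem_chords_iff.2 ⟨coe_ne_coe_of_mem_Ioo htc.le hds.le hx hy, h⟩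
    refine ⟨⟨hm, (crosses_coe_iff hst hts _).2
        ⟨x, hx, y, ⟨by linarith [hy.1], by linarith [hy.2]⟩, rfl⟩⟩,
      ⟨hm, (crosses_coe_iff hcd hdc _).2
        -- Seen from the second chord, the complementary arc is `(d, c + 1)`, where the endpoint `x`
        -- has the lift `x + 1`.
        ⟨y, hy, x + 1, ⟨by linarith [hx.1], by linarith [hx.2]⟩, ?_⟩⟩⟩
    rw [AddCircle.coe_add_period, Sym2.eq_swap]

theorem even_ncard_crossing {c : Sym2 UnitAddCircle} (hc : c ∈ C.gaussDiagram.chords) :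
    Even (C.gaussDiagram.crossing c).ncard := by
  induction c with | _ a b
  obtain ⟨hne, h⟩ := C.mk_mem_chords_iff.1 hc
  obtain ⟨s, t, hst, hts, rfl, rfl⟩ := exists_lift_pair hne
  rw [C.crossing_eq_image hst hts,
    (C.injOn_mk_crossingParams hst hts le_rfl le_rfl).ncard_image]
  exact C.even_ncard_crossingParams_complement hst hts h

theorem even_ncard_crossing_inter_crossing {a b : Sym2 UnitAddCircle}
    (ha : a ∈ C.gaussDiagram.chords) (hb : b ∈ C.gaussDiagram.chords) (h : ¬ Crosses a b) :
    Even (C.gaussDiagram.crossing a ∩ C.gaussDiagram.crossing b).ncard := by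
  -- A chord does not cross itself, so equal chords are admitted; for them the claim is the parity
  -- of a single crossing set.
  by_cases hab : a = b
  · subst hab
    rw [inter_self]
    exact C.even_ncard_crossing ha
  · obtain ⟨s, t, c, d, hst, htc, hcd, hds, rfl, rfl⟩ := exists_lifts_of_not_crosses
      (C.gaussDiagram.not_isDiag a ha) (C.gaussDiagram.not_isDiag b hb)
      (fun x hxa hxb => hab (C.gaussDiagram.eq_of_mem a ha b hb x hxa hxb)) h
    rw [C.crossing_inter_crossing_eq_image hst htc hcd hds,
      (C.injOn_mk_crossingParams hst hcd htc.le hds.le).ncard_image]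
    exact C.even_ncard_crossingParams_of_lt hst hcd htc hds (C.mk_mem_chords_iff.1 ha).2
      (C.mk_mem_chords_iff.1 hb).2

theorem evenCondition_gaussDiagram : C.gaussDiagram.EvenCondition :=
  ⟨fun _ ha _ hb h => C.even_ncard_crossing_inter_crossing ha hb h,
    fun _ hc => C.even_ncard_crossing hc⟩

end PlaneCurve

theorem proposition3p1 :
    (∀ C : PlaneCurve,
      (∀ a ∈ C.gaussDiagram.chords, ∀ b ∈ C.gaussDiagram.chords, ¬ Crosses a b →
        Even (C.gaussDiagram.crossing a ∩ C.gaussDiagram.crossing b).ncard) ∧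
      (∀ c ∈ C.gaussDiagram.chords, Even (C.gaussDiagram.crossing c).ncard)) ∧
    (∀ G : GaussDiagram, G.IsRealizable → G.EvenCondition) :=
  ⟨fun C => C.evenCondition_gaussDiagram,
    fun _ ⟨C, h⟩ => C.evenCondition_gaussDiagram.of_equivalent h⟩
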